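/- Let $k$ be a finite field with $q$ elements and characteristic $p$, let $n\ge 1$, $\mathcal G=\mathrm M_n(k)$ and $G=\mathrm{GL}_n(k)$. Let $R$ be an algebraically closed field of characteristic $\ell\neq p$ ($\ell=0$ is allowed), and fix $s\in R$ with $s^2=|\mathcal G|$ in $R$. For a non-trivial character $\psi:k\to R^\times$ and $\Phi:\mathcal G\to R$ put $$\mathcal F_\psi(\Phi)(a)=s^{-1}\sum_{g\in\mathcal G}\Phi(g)\,\psi(\mathrm{tr}(ga)).$$ For a representation $(\pi,V)$ of $G$ over $R$, $v\in V$ and $v^\vee\in V^\vee=\mathrm{Hom}_R(V,R)$, let $f_{v,v^\vee}(g)=v^\vee(\pi(g)v)$; for $f:G\to R$ let $f^\vee(g)=f(g^{-1})$ and $\mathcal Z(\Phi,f)=\sum_{g\in G}\Phi(g)f(g)$. The representation $\pi$ satisfies the strong functional equation if for every non-trivial character $\psi:k\to R^\times$ there is $\gamma(\pi,\psi)\in R$ with $$\mathcal Z\big(\mathcal F_\psi(\Phi),(f_{v,v^\vee})^\vee\big)=\gamma(\pi,\psi)\,\mathcal Z(\Phi,f_{v,v^\vee})$$ for all $\Phi:\mathcal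 G\to R$, $v\in V$, $v^\vee\in V^\vee$. It satisfies the weak functional equation if for every non-trivial $\psi$ there is such a constant for which the identity holds for all $\Phi$ that vanish outside $G$ and all $v,v^\vee$. A representation of a group $\mathrm{GL}_m(k)$ is cuspidal if its coinvariants under the unipotent radical of every proper parabolic subgroup are zero. For irreducible cuspidal $R$-representations $\rho_a$ of $\mathrm{GL}_{n_a}(k)$, $1\le a\le r$, with $n_a\ge 1$ and $n_1+\dots+n_r=n$, let $\rho_1\times\dots\times\rho_r$ be the representation of $G$ induced from $\rho_1\otimes\dots\otimes\rho_r$, inflated to the standard block upper triangular parabolic subgroup of type $(n_1,\dots,n_r)$. A family $\{\rho_1,\dots,\rho_r\}$ such that $\pi$ is isomorphic to a quotient of $\rho_1\times\dots\times\rho_r$ is called a cuspidal support of $\pi$ (it is well known to be unique up to isomorphism and order). Theorem. Let $(\pi,V)$ be an irreducible $R$-representation of $G$. Then $\pi$ has a cuspidal support, and: 1. $\pi$ satisfies the weak functional equation. 2. If moreover either - $\pi$ has a cuspidal support that does not contain the trivial character of $k^\times=\mathrm{GL}_1(k)$, or - $\ell\neq 0$ and $\ell$ divides $q-1$, then $\pi$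 satisfies the strong functional equation. -/

import Mathlib

open scoped TensorProduct MatrixGroups

universe u v w

namespace GodementJacquet

section Fourier

variable {R k V ι : Type*} [Field R] [Field k] [Fintype k] [DecidableEq k]
  [Fintype ι] [DecidableEq ι] [AddCommGroup V] [Module R V]

/-- The normalized Fourier transform of a function `Φ` on the matrix algebra `M_ι(k)`, with respect
to the additive character `ψ` of `k`; the normalization is by the inverse of `s`, a square root of
the cardinality of the matrix algebra. -/
def fourier (s : R) (ψ : AddChar k R) (Φ : Matrix ι ι k → R) : Matrix ι ι k → R :=
  fun a => s⁻¹ * ∑ g : Matrix ι ι k, Φ g * ψ (Matrix.trace (g * a))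

/-- The matrix coefficient `g ↦ v'(π(g) v)`. -/
def matrixCoeff (π : Representation R (GL ι k) V) (v : V) (v' : Module.Dual R V) : GL ι k → R :=
  fun g => v' (π g v)

/-- For a function `f` on the group, the function `g ↦ f(g⁻¹)`. -/
def invArg (f : GL ι k → R) : GL ι k → R := fun g => f g⁻¹

/-- The Godement-Jacquet sum. -/
def zetaSum (Φ : Matrix ι ι k → R) (f : GL ι k → R) : R :=
  ∑ g : GL ι k, Φ (g : Matrix ι ι k) * f g

/-- The strong functional equation with respect to `ψ`. -/
def StrongFEAt (s : R) (ψ : AddChar k R) (π : Representation R (GL ι k) V) : Prop :=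
  ∃ γ : R, ∀ (Φ : Matrix ι ι k → R) (v : V) (v' : Module.Dual R V),
    zetaSum (fourier s ψ Φ) (invArg (matrixCoeff π v v')) = γ * zetaSum Φ (matrixCoeff π v v')

/-- The weak functional equation with respect to `ψ`: only functions `Φ` with support in the
group of invertible matrices are considered. -/
def WeakFEAt (s : R) (ψ : AddChar k R) (π : Representation R (GL ι k) V) : Prop :=
  ∃ γ : R, ∀ Φ : Matrix ι ι k → R, (∀ x, ¬ IsUnit x → Φ x = 0) →
    ∀ (v : V) (v' : Module.Dual R V),
      zetaSum (fourier s ψ Φ) (invArg (matrixCoeff π v v')) = γ * zetaSum Φ (matrixCoeff π v v')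

/-- The strong functional equation, for all non-trivial additive characters. -/
def StrongFE (s : R) (π : Representation R (GL ι k) V) : Prop :=
  ∀ ψ : AddChar k R, ψ ≠ 1 → StrongFEAt s ψ π

/-- The weak functional equation, for all non-trivial additive characters. -/
def WeakFE (s : R) (π : Representation R (GL ι k) V) : Prop :=
  ∀ ψ : AddChar k R, ψ ≠ 1 → WeakFEAt s ψ π

end Fourier

section Parabolic

variable {k ι α : Type*} [Field k] [Fintype ι] [DecidableEq ι] [LinearOrder α]

/-- Diagonal blocks of block triangular matrices multiply. -/
theorem toSquareBlock_mul {b : ι → α} {M N : Matrix ι ι k} (hM : M.BlockTriangular b)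
    (hN : N.BlockTriangular b) (a : α) :
    (M * N).toSquareBlock b a = M.toSquareBlock b a * N.toSquareBlock b a := by
  ext ⟨i, hi⟩ ⟨j, hj⟩
  change ∑ l, M i l * N l j = ∑ l : {l // b l = a}, M i l * N l j
  symm
  refine Fintype.sum_of_injective Subtype.val Subtype.val_injective _ _ (fun l hl => ?_)
    fun _ => rfl
  have hne : b l ≠ a := fun h => hl ⟨⟨l, h⟩, rfl⟩
  rcases lt_or_gt_of_ne hne with h | h
  · rw [hM (show b l < b i by rw [hi]; exact h), zero_mul]
  · rw [hN (show b j < b l by rw [hj]; exact h), mul_zero]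

/-- The diagonal blocks of the identity matrix are identity matrices. -/
theorem toSquareBlock_one (b : ι → α) (a : α) :
    (1 : Matrix ι ι k).toSquareBlock b a = 1 := by
  ext i j
  simp [Matrix.toSquareBlock_def, Matrix.one_apply, Subtype.ext_iff]

/-- The parabolic subgroup of invertible matrices that are block upper triangular with respect to
the ordered partition of the index set into the fibres of `b`. -/
def parabolic (k : Type*) [Field k] (b : ι → α) : Subgroup (GL ι k) where
  carrier := {g | (g : Matrix ι ι k).BlockTriangular b}
  mul_mem' {g h} hg hh := by
    simpa using Matrix.BlockTriangular.mul hg hh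
  one_mem' := by simpa using Matrix.blockTriangular_one
  inv_mem' {g} hg := by
    have := Units.invertible g
    have h := Matrix.blockTriangular_inv_of_blockTriangular (M := (g : Matrix ι ι k)) hg
    simpa [Matrix.coe_units_inv] using h

/-- The projection of a block triangular group onto its diagonal block with label `a`. -/
def diagBlock (b : ι → α) (a : α) : parabolic k b →* GL {i // b i = a} k where
  toFun g :=
    { val := ((g : GL ι k) : Matrix ι ι k).toSquareBlock b a
      inv := ((g⁻¹ : parabolic k b) : GL ι k).val.toSquareBlock b a
      val_inv := by
        rw [← toSquareBlock_mul g.2 (g⁻¹).2, ← Units.val_mul, ← Subgroup.coe_mul, mul_inv_cancel]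
        exact toSquareBlock_one b a
      inv_val := by
        rw [← toSquareBlock_mul (g⁻¹).2 g.2, ← Units.val_mul, ← Subgroup.coe_mul, inv_mul_cancel]
        exact toSquareBlock_one b a }
  map_one' := Units.ext (toSquareBlock_one b a)
  map_mul' g h := Units.ext (toSquareBlock_mul g.2 h.2 a)

/-- The projection of a block triangular group onto the product of its diagonal blocks. -/
def leviProj (b : ι → α) : parabolic k b →* ((a : α) → GL {i // b i = a} k) :=
  MonoidHom.pi (diagBlock b)

/-- The unipotent radical of `parabolic k b`: the block upper triangular matrices all of whose
diagonal blocks are identity matrices. -/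
def unipotentRadical (k : Type*) [Field k] (b : ι → α) : Subgroup (GL ι k) :=
  (leviProj (k := k) b).ker.map (parabolic k b).subtype

end Parabolic

section Cuspidal

/-- A representation of `GL_ι(k)` is cuspidal if its coinvariants under the unipotent radical of
every proper parabolic subgroup vanish. Every parabolic subgroup is conjugate, by some `x`, to a
group `parabolic k b` with `b : ι → ℕ`, and it is proper if and only if `b` is not constant. -/
def IsCuspidal {R k V ι : Type*} [Field R] [Field k] [Fintype ι] [DecidableEq ι]
    [AddCommGroup V] [Module R V] (π : Representation R (GL ι k) V) : Prop :=
  ∀ (b : ι → ℕ) (x : GL ι k), (∃ i j, b i ≠ b j) →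
    Subsingleton (Representation.Coinvariants
      (π.comp ((unipotentRadical k b).map (MulAut.conj x).toMonoidHom).subtype))

/-- Irreducible cuspidal representations `ρ₁, …, ρ_r` of `GL_{n₁}(k), …, GL_{n_r}(k)`, where
`n₁ + ⋯ + n_r = n` and all `n_a ≥ 1`. The composition of `n` is given by the monotone
surjection `b : Fin n → Fin r` whose fibres are the consecutive blocks, of sizes `n₁, …, n_r`.
The spaces may be taken in the universe of `R` since irreducible representations of finite groups
are finite dimensional. -/
structure CuspidalDatum (R : Type u) [Field R] (k : Type v) [Field k] (n : ℕ) where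
  r : ℕ
  b : Fin n → Fin r
  mono : Monotone b
  surj : Function.Surjective b
  W : Fin r → Type u
  [addCommGroup : ∀ a, AddCommGroup (W a)]
  [module : ∀ a, Module R (W a)]
  ρ : ∀ a, Representation R (GL {i // b i = a} k) (W a)
  irreducible : ∀ a, (ρ a).IsIrreducible
  cuspidal : ∀ a, IsCuspidal (ρ a)

attribute [instance] CuspidalDatum.addCommGroup CuspidalDatum.module

namespace CuspidalDatum

variable {R : Type u} [Field R] {k : Type v} [Field k] {n : ℕ}

/-- The representation `ρ₁ ⊗ ⋯ ⊗ ρ_r` of the standard parabolic subgroup, through its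
projection onto `GL_{n₁}(k) × ⋯ × GL_{n_r}(k)`. -/
def inflation (D : CuspidalDatum R k n) :
    Representation R (parabolic k D.b) (⨂[R] a, D.W a) :=
  PiTensorProduct.mapMonoidHom.comp
    (MonoidHom.pi fun a => (D.ρ a).comp (diagBlock D.b a))

/-- The parabolically induced representation `ρ₁ × ⋯ × ρ_r` of `GL_n(k)`, on the functions
`f` with `f (p g) = (ρ₁ ⊗ ⋯ ⊗ ρ_r)(p) (f g)` for `p` in the standard parabolic subgroup. -/
def parabolicInduction (D : CuspidalDatum R k n) :
    Representation R (GL (Fin n) k)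
      (Representation.coindV (parabolic k D.b).subtype D.inflation) :=
  Representation.coind (parabolic k D.b).subtype D.inflation

/-- `{ρ₁, …, ρ_r}` is the cuspidal support of `π`: the representation `π` is isomorphic to a
quotient of `ρ₁ × ⋯ × ρ_r`. -/
def IsCuspidalSupportOf {V : Type*} [AddCommGroup V] [Module R V] (D : CuspidalDatum R k n)
    (π : Representation R (GL (Fin n) k) V) : Prop :=
  ∃ f : D.parabolicInduction.IntertwiningMap π, Function.Surjective f

/-- One of the `ρ_a` is the trivial character of `GL_1(k)`. -/
def ContainsTrivial (D : CuspidalDatum R k n) : Prop :=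
  ∃ a, Fintype.card {i // D.b i = a} = 1 ∧ ∀ g, D.ρ a g = 1

end CuspidalDatum

end Cuspidal

end GodementJacquet

/-! For a matrix `x` put `T(x) = ∑ g, ψ(tr(x g)) π(g⁻¹)`. Interchanging sums turns the left side of
the functional equation into `s⁻¹ ∑ x, Φ(x) v'(T(x) v)` (`zetaSum_fourier`). For invertible `x` a
translation gives `T(x) = T(1) π(x)`, and `T(1)` commutes with `π`, so by Schur's lemma `T(x) = c
π(x)`. Hence the equation holds with `γ = s⁻¹ c` whenever singular matrices contribute nothing
(`exists_functionalEquation`). For the weak equation this is the support condition on `Φ`; for the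
strong one `T(x) = 0` is needed at every singular `x`.

This vanishing is checked on the parabolically induced representation, of which `π` is a quotient.
At a point `h` one chooses a row vector `μ ≠ 0` with `μ h x = 0`. Elements `1 + v ⊗ μ` fix `h x`
under left multiplication, so the sum vanishes once a group of such elements inside the parabolic
has operator sum zero in the inducing representation. In the first block where `μ` is non-zero,
cuspidality provides such a group if the block has size at least 2; in size 1 a sum of a character
over `kˣ` is needed, and it is zero if the character is non-trivial or `q - 1 = 0` in `R`
(`CuspidalDatum.exists_sum_inflation_eq_zero`).

A cuspidal support comes from a partition with as many blocks as possible whose unipotent radical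
has non-zero invariants in `π`. Irreducible constituents of the Levi action on these invariants are
cuspidal by maximality, and Frobenius reciprocity makes `π` a quotient of their induction. -/

namespace GodementJacquet

open scoped Matrix

section GroupSums

/-- A sum over a finite group vanishes if its partial sums over the right cosets of a subgroup,
here the image of an injective homomorphism, vanish. -/
theorem sum_eq_zero_of_sum_coset {G A M : Type*} [Group G] [Fintype G] [Group A] [Fintype A]
    [AddCommMonoid M] (φ : A →* G) (hφ : Function.Injective φ) (F : G → M)
    (h : ∀ x, ∑ a, F (φ a * x) = 0) : ∑ g, F g = 0 := by
  classical
  obtain ⟨T, hT, -⟩ := Subgroup.exists_isComplement_right φ.range 1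
  have e := (Fintype.sum_bijective (fun x : φ.range × T => (x.1 : G) * x.2) hT
    (fun x => F (x.1 * x.2)) F fun _ => rfl)
  rw [← e, Fintype.sum_prod_type_right]
  refine Finset.sum_eq_zero fun t _ => ?_
  rw [← h t]
  exact (Fintype.sum_equiv (MonoidHom.ofInjective hφ).toEquiv _ _ fun a => rfl).symm

end GroupSums

/-! ### Rank-one perturbations `1 + v ⊗ μ` of the identity. -/

section RankOne

variable {k ι A : Type*} [Field k] [Fintype ι] [DecidableEq ι]

theorem one_add_vecMulVec_mul (v w μ : ι → k) :
    (1 + Matrix.vecMulVec v μ) * (1 + Matrix.vecMulVec w μ) =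
      1 + Matrix.vecMulVec (v + w + (μ ⬝ᵥ w) • v) μ := by
  rw [mul_add, add_mul, add_mul, Matrix.vecMulVec_mul_vecMulVec]
  ext i j
  simp [Matrix.vecMulVec_apply]
  ring

/-- The homomorphism `a ↦ 1 + f(a) ⊗ μ` for a family of vectors `f(a)` killed by `μ`. -/
noncomputable def transvectionHom [AddCommGroup A] (f : A →+ (ι → k)) (μ : ι → k)
    (h : ∀ a, μ ⬝ᵥ f a = 0) : Multiplicative A →* GL ι k :=
  MonoidHom.toHomUnits
    { toFun := fun a => 1 + Matrix.vecMulVec (f a.toAdd) μ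
      map_one' := by simp
      map_mul' := fun a a' => by simp [one_add_vecMulVec_mul, h] }

theorem transvectionHom_coe [AddCommGroup A] (f : A →+ (ι → k)) (μ : ι → k)
    (h : ∀ a, μ ⬝ᵥ f a = 0) (a : Multiplicative A) :
    (transvectionHom f μ h a : Matrix ι ι k) = 1 + Matrix.vecMulVec (f a.toAdd) μ := rfl

/-- The homomorphism `t ↦ 1 + (t - 1) v ⊗ μ` where `μ(v) = 1`. -/
noncomputable def dilationHom (v μ : ι → k) (h : μ ⬝ᵥ v = 1) : kˣ →* GL ι k :=
  MonoidHom.toHomUnits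
    { toFun := fun t => 1 + Matrix.vecMulVec (((t : k) - 1) • v) μ
      map_one' := by simp
      map_mul' := fun t t' => by
        rw [one_add_vecMulVec_mul]
        congr 2
        simp only [dotProduct_smul, h, smul_eq_mul, mul_one, ← add_smul, smul_smul]
        congr 1
        push_cast
        ring }

theorem dilationHom_coe (v μ : ι → k) (h : μ ⬝ᵥ v = 1) (t : kˣ) :
    (dilationHom v μ h t : Matrix ι ι k) = 1 + Matrix.vecMulVec (((t : k) - 1) • v) μ := rfl

theorem vecMulVec_left_injective {μ : ι → k} (hμ : μ ≠ 0) :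
    Function.Injective fun v : ι → k => Matrix.vecMulVec v μ := by
  intro v w h
  obtain ⟨i, hi⟩ := Function.ne_iff.1 hμ
  ext j
  have := congrFun (congrFun h j) i
  exact mul_right_cancel₀ hi this

variable {α : Type*} [LinearOrder α]

/-- An element `1 + v ⊗ μ` is block triangular if `v` is supported in one block and `μ` vanishes on
the blocks before it. -/
theorem blockTriangular_one_add_vecMulVec {b : ι → α} {a : α} {v μ : ι → k}
    (hv : ∀ i, b i ≠ a → v i = 0) (hμ : ∀ i, b i < a → μ i = 0) :
    (1 + Matrix.vecMulVec v μ).BlockTriangular b := by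
  refine Matrix.blockTriangular_one.add fun i j hij => ?_
  rw [Matrix.vecMulVec_apply]
  by_cases h : b i = a
  · rw [hμ j (h ▸ hij), mul_zero]
  · rw [hv i h, zero_mul]

theorem toSquareBlock_one_add_vecMulVec (b : ι → α) (a : α) (v μ : ι → k) :
    (1 + Matrix.vecMulVec v μ).toSquareBlock b a =
      1 + Matrix.vecMulVec (fun i : {i // b i = a} => v i) (fun i : {i // b i = a} => μ i) := by
  ext i j
  simp [Matrix.toSquareBlock_def, Matrix.vecMulVec_apply, Matrix.one_apply, Subtype.ext_iff]

theorem mem_unipotentRadical_iff {b : ι → α} {g : GL ι k} :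
    g ∈ unipotentRadical k b ↔
      ∀ i j, b j ≤ b i → (g : Matrix ι ι k) i j = (1 : Matrix ι ι k) i j := by
  constructor
  · rintro ⟨p, hp, rfl⟩ i j hij
    rcases hij.lt_or_eq with h | h
    · have hne : i ≠ j := by rintro rfl; exact lt_irrefl _ h
      rw [Matrix.one_apply_ne hne]
      exact p.2 h
    · have h1 : diagBlock b (b i) p = 1 := congrFun (MonoidHom.mem_ker.1 hp) (b i)
      have h2 : (diagBlock b (b i) p).val ⟨i, rfl⟩ ⟨j, h⟩ =
          (1 : GL {l // b l = b i} k).val ⟨i, rfl⟩ ⟨j, h⟩ := by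
        rw [h1]
      change (p : GL ι k).val i j = (1 : Matrix _ _ k) _ _ at h2
      rw [Subgroup.subtype_apply, h2]
      simp [Matrix.one_apply]
  · intro h
    have hg : g ∈ parabolic k b := fun i j hij => by
      have hne : i ≠ j := by rintro rfl; exact lt_irrefl _ hij
      rw [h i j hij.le, Matrix.one_apply_ne hne]
    refine ⟨⟨g, hg⟩, ?_, rfl⟩
    refine MonoidHom.mem_ker.2 (funext fun a => Units.ext ?_)
    ext ⟨i, hi⟩ ⟨j, hj⟩
    change g.val i j = (1 : Matrix _ _ k) _ _
    rw [h i j (by rw [hi, hj])]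
    simp [Matrix.one_apply]

end RankOne

section Irreducible

/-- An invariant subspace of an irreducible representation is zero or everything. -/
theorem eq_bot_or_eq_top_of_invariant {R G V : Type*} [Field R] [Group G] [AddCommGroup V]
    [Module R V] {ρ : Representation R G V} (hρ : ρ.IsIrreducible) (W : Submodule R V)
    (hW : ∀ g, ∀ v ∈ W, ρ g v ∈ W) : W = ⊥ ∨ W = ⊤ := by
  rcases hρ.eq_bot_or_eq_top ⟨W, fun g v hv => hW g v hv⟩ with h | h
  · exact Or.inl (congrArg Subrepresentation.toSubmodule h)
  · exact Or.inr (congrArg Subrepresentation.toSubmodule h)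

end Irreducible

/-! ### Vanishing operator sums for a single block. -/

section CuspidalSums

variable {R k ι V : Type*} [Field R] [Field k] [Fintype k] [DecidableEq k] [Fintype ι]
  [DecidableEq ι] [AddCommGroup V] [Module R V]

/-- For a cuspidal representation, the sum of the operators of all elements `1 + v ⊗ μ` with
`μ(v) = 0` vanishes. -/
theorem IsCuspidal.sum_transvection_eq_zero {ρ : Representation R (GL ι k) V} (hρ : IsCuspidal ρ)
    (hι : Nontrivial ι) {A : Type*} [AddCommGroup A] [Fintype A] (f : A →+ (ι → k)) {μ : ι → k}
    (hμ : μ ≠ 0) (h : ∀ a, μ ⬝ᵥ f a = 0) (hf : ∀ v, μ ⬝ᵥ v = 0 → ∃ a, f a = v) (w : V) :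
    ∑ a, ρ (transvectionHom f μ h a) w = 0 := by
  obtain ⟨i₀, hi₀⟩ := Function.ne_iff.1 hμ
  -- Conjugation by this matrix, whose row `i₀` is `μ`, reduces `μ` to the coordinate form at `i₀`.
  have hdet : IsUnit ((1 : Matrix ι ι k).updateRow i₀ μ).det := by
    have h1 := Matrix.det_updateRow_sum (1 : Matrix ι ι k) i₀ μ
    have h2 : ∑ i, μ i • (1 : Matrix ι ι k) i = μ := by
      ext j
      simp [Finset.sum_apply, Matrix.one_apply]
    rw [h2, Matrix.det_one, smul_eq_mul, mul_one] at h1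
    rw [h1]
    exact isUnit_iff_ne_zero.2 hi₀
  let y : GL ι k := Matrix.GeneralLinearGroup.mk'' _ hdet
  have hy : (Pi.single i₀ 1) ᵥ* (y : Matrix ι ι k) = μ := by
    rw [Matrix.single_one_vecMul]
    exact Matrix.updateRow_self
  obtain ⟨i₁, hi₁⟩ := exists_ne i₀
  -- With `i₀` as the last block, the radical consists of the `1 + x ⊗ e` with `e` the coordinate
  -- form at `i₀` and `x i₀ = 0`.
  have hsub := hρ (fun i => if i = i₀ then 1 else 0) y⁻¹ ⟨i₀, i₁, by simp [hi₁]⟩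
  set U := (unipotentRadical k fun i => if i = i₀ then 1 else 0).map
    (MulAut.conj y⁻¹).toMonoidHom
  have hU : ∀ u ∈ U, ∃ a, transvectionHom f μ h a = u := by
    rintro _ ⟨u, hu, rfl⟩
    rw [SetLike.mem_coe, mem_unipotentRadical_iff] at hu
    let x : ι → k := fun i => if i = i₀ then 0 else u.val i i₀
    have hux : u.val = 1 + Matrix.vecMulVec x (Pi.single i₀ 1) := by
      ext i j
      rw [Matrix.add_apply, Matrix.vecMulVec_apply]
      by_cases hj : j = i₀
      · subst hj
        by_cases hi : i = j
        · subst hi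
          rw [hu i i le_rfl]
          simp [x]
        · simp [x, hi]
      · rw [hu i j (by simp [hj])]
        simp [hj]
    have hx : μ ⬝ᵥ ((y⁻¹ : GL ι k).val *ᵥ x) = 0 := by
      rw [← hy, ← Matrix.dotProduct_mulVec, Matrix.mulVec_mulVec, ← Units.val_mul, mul_inv_cancel]
      simp [x]
    obtain ⟨a, ha⟩ := hf _ hx
    refine ⟨Multiplicative.ofAdd a, Units.ext ?_⟩
    rw [transvectionHom_coe]
    change 1 + Matrix.vecMulVec (f a) μ = (y⁻¹).val * u.val * (y⁻¹⁻¹).val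
    rw [hux, mul_add, add_mul, mul_one, ← Units.val_mul, mul_inv_cancel, Matrix.mul_vecMulVec,
      Matrix.vecMulVec_mul, inv_inv, hy, ha]
    rfl
  -- Precomposing with an element of `U` only permutes the summands, so `E` factors through the
  -- coinvariants, which are zero.
  let E : V →ₗ[R] V := ∑ a, ρ (transvectionHom f μ h a)
  have hE : ∀ u : U, E ∘ₗ (ρ.comp U.subtype) u = E := by
    rintro ⟨u, hu⟩
    obtain ⟨a, rfl⟩ := hU u hu
    ext w
    simp only [E, LinearMap.comp_apply, LinearMap.sum_apply]
    refine Fintype.sum_equiv (Equiv.mulRight a) _ _ fun a' => ?_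
    simp
  have h0 : E w = 0 := by
    rw [← Representation.Coinvariants.lift_mk _ E hE, Subsingleton.elim
      (Representation.Coinvariants.mk (ρ.comp U.subtype) w) 0, map_zero]
  simpa [E] using h0

/-- For a non-trivial irreducible representation of `GL_1(k)`, or for any one if `q - 1 = 0` in
`R`, the sum of the operators of all elements vanishes. -/
theorem sum_scalar_eq_zero {ρ : Representation R (GL ι k) V} (hρ : ρ.IsIrreducible)
    (hι : Fintype.card ι = 1) (h : (∀ g, ρ g = 1) → ((Fintype.card k - 1 : ℕ) : R) = 0) (w : V) :
    ∑ t : kˣ, ρ (Units.map (Matrix.scalar ι : k →+* Matrix ι ι k).toMonoidHom t) w = 0 := by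
  obtain ⟨i₀, hi₀⟩ := Fintype.card_eq_one_iff.1 hι
  have hs : ∀ g : GL ι k, ∃ t : kˣ,
      g = Units.map (Matrix.scalar ι : k →+* Matrix ι ι k).toMonoidHom t := by
    intro g
    have : g.val i₀ i₀ * (g⁻¹).val i₀ i₀ = 1 := by
      have h1 : (g.val * (g⁻¹).val) i₀ i₀ = (1 : Matrix ι ι k) i₀ i₀ := by
        rw [← Units.val_mul, mul_inv_cancel, Units.val_one]
      rw [Matrix.mul_apply, Fintype.sum_eq_single i₀ fun j hj => absurd (hi₀ j) hj]
        at h1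
      simpa using h1
    refine ⟨Units.mk0 (g.val i₀ i₀) (left_ne_zero_of_mul_eq_one this), Units.ext ?_⟩
    ext i j
    rw [hi₀ i, hi₀ j]
    simp
  set c : kˣ →* GL ι k := Units.map (Matrix.scalar ι : k →+* Matrix ι ι k).toMonoidHom 
  by_cases htriv : ∀ g, ρ g = 1
  · simp only [htriv, Module.End.one_apply, Finset.sum_const, Finset.card_univ]
    rw [Fintype.card_units, ← Nat.cast_smul_eq_nsmul R, h htriv, zero_smul]
  · push Not at htriv
    obtain ⟨g, hg⟩ := htriv
    obtain ⟨t₀, rfl⟩ := hs g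
    -- The fixed space of `c t₀` is invariant because the group is commutative; it contains the sum
    -- and is not everything.
    rcases eq_bot_or_eq_top_of_invariant hρ (LinearMap.ker (ρ (c t₀) - 1)) (fun g v hv => by
      obtain ⟨t, rfl⟩ := hs g
      rw [LinearMap.mem_ker, LinearMap.sub_apply, sub_eq_zero, Module.End.one_apply] at hv ⊢
      rw [← Module.End.mul_apply, ← map_mul, ← map_mul, mul_comm, map_mul, map_mul,
        Module.End.mul_apply, hv]) with h1 | h1
    · have h2 : ∑ t : kˣ, ρ (c t) w ∈ LinearMap.ker (ρ (c t₀) - 1) := by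
        rw [LinearMap.mem_ker, LinearMap.sub_apply, sub_eq_zero, Module.End.one_apply, map_sum]
        refine Fintype.sum_equiv (Equiv.mulLeft t₀) _ _ fun t => ?_
        simp
      rwa [h1, Submodule.mem_bot] at h2
    · exact absurd (sub_eq_zero.1 (LinearMap.ker_eq_top.1 h1)) hg

end CuspidalSums

/-! ### Vanishing operator sums for the inducing representation. -/

section Inflation

variable {R : Type u} [Field R] {k : Type v} [Field k] {n : ℕ}

/-- The sum of the operators of a family of elements of a parabolic subgroup with only one
non-trivial diagonal block vanishes if it does so for that block. -/
theorem CuspidalDatum.sum_inflation_eq_zero (D : CuspidalDatum R k n) {A : Type*} [Fintype A]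
    (φ : A → parabolic k D.b) (j : Fin D.r) (h1 : ∀ a i, i ≠ j → diagBlock D.b i (φ a) = 1)
    (h2 : ∀ w, ∑ a, D.ρ j (diagBlock D.b j (φ a)) w = 0) : ∑ a, D.inflation (φ a) = 0 := by
  refine PiTensorProduct.ext (MultilinearMap.ext fun w => ?_)
  have h3 : ∀ a, D.inflation (φ a) (PiTensorProduct.tprod R w) =
      PiTensorProduct.tprod R (Function.update w j (D.ρ j (diagBlock D.b j (φ a)) (w j))) := by
    intro a
    refine (PiTensorProduct.map_tprod _ _).trans ?_
    congr 1
    ext i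
    by_cases hi : i = j
    · subst hi
      simp
    · simp [hi, h1 a i hi]
  rw [LinearMap.compMultilinearMap_apply, LinearMap.sum_apply, Finset.sum_congr rfl fun a _ => h3 a,
    ← MultilinearMap.map_update_sum, h2, MultilinearMap.map_update_zero]
  rfl

/-- Extension of vectors by zero from one block to the whole index set. -/
def extendBlock {ι' : Type*} [DecidableEq ι'] (b : Fin n → ι') (j : ι') :
    ({i // b i = j} → k) →+ (Fin n → k) where
  toFun v i := if h : b i = j then v ⟨i, h⟩ else 0
  map_zero' := by ext; simp
  map_add' v w := by ext i; by_cases h : b i = j <;> simp [h]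

theorem extendBlock_apply {ι' : Type*} [DecidableEq ι'] {b : Fin n → ι'} {j : ι'}
    (v : {i // b i = j} → k) (i : {i // b i = j}) : extendBlock b j v i = v i := by
  simp [extendBlock, i.2]

theorem extendBlock_apply_of_ne {ι' : Type*} [DecidableEq ι'] {b : Fin n → ι'} {j : ι'}
    (v : {i // b i = j} → k) {i : Fin n} (h : b i ≠ j) : extendBlock b j v i = 0 := by
  simp [extendBlock, h]

theorem dotProduct_extendBlock {ι' : Type*} [DecidableEq ι'] (b : Fin n → ι') (j : ι')
    (μ : Fin n → k) (v : {i // b i = j} → k) :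
    μ ⬝ᵥ extendBlock b j v = (fun i : {i // b i = j} => μ i) ⬝ᵥ v := by
  symm
  refine Fintype.sum_of_injective Subtype.val Subtype.val_injective _ _ (fun i hi => ?_) fun i => ?_
  · rw [extendBlock_apply_of_ne, mul_zero]
    exact fun h => hi ⟨⟨i, h⟩, rfl⟩
  · rw [extendBlock_apply]

variable [Fintype k] [DecidableEq k]

/-- Let `j` be the first block where `μ` is non-zero. For `v` supported in block `j`, the element `1
+ v ⊗ μ` is block upper triangular and only its `j`-th diagonal block can be non-trivial, so
everything reduces to `ρ j`. -/
theorem CuspidalDatum.exists_sum_inflation_eq_zero (D : CuspidalDatum R k n)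
    (hD : D.ContainsTrivial → ((Fintype.card k - 1 : ℕ) : R) = 0) {μ : Fin n → k} (hμ : μ ≠ 0) :
    ∃ (A : Type v) (_ : Group A) (_ : Fintype A) (φ : A →* parabolic k D.b),
      Function.Injective φ ∧ (∀ a, ∃ v, (φ a).1.val = 1 + Matrix.vecMulVec v μ) ∧
        ∑ a, D.inflation (φ a) = 0 := by
  obtain ⟨i₀, hi₀, hmin⟩ := Set.exists_min_image {i | μ i ≠ 0} D.b (Set.toFinite _)
    (Function.ne_iff.1 hμ)
  obtain ⟨j, hj⟩ : ∃ j, D.b i₀ = j := ⟨_, rfl⟩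
  have hμj : ∀ i, D.b i < j → μ i = 0 := fun i hi => by
    by_contra h
    exact absurd (hmin i h) (not_le.2 (hj ▸ hi))
  let μ' : {i // D.b i = j} → k := fun i => μ i
  have hμ' : μ' ≠ 0 := fun h => hi₀ (congrFun h ⟨i₀, hj⟩)
  have key : ∀ (A : Type v) [Group A] [Fintype A] (φ : A →* GL (Fin n) k)
      (f : A → {i // D.b i = j} → k),
      (∀ a, (φ a).val = 1 + Matrix.vecMulVec (extendBlock D.b j (f a)) μ) → Function.Injective f →
      (∀ g : A → GL {i // D.b i = j} k, (∀ a, (g a).val = 1 + Matrix.vecMulVec (f a) μ') →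
        ∀ w, ∑ a, D.ρ j (g a) w = 0) →
      ∃ (A : Type v) (_ : Group A) (_ : Fintype A) (φ : A →* parabolic k D.b),
        Function.Injective φ ∧ (∀ a, ∃ v, (φ a).1.val = 1 + Matrix.vecMulVec v μ) ∧
          ∑ a, D.inflation (φ a) = 0 := by
    intro A _ _ φ f hφ hf hsum
    refine ⟨A, inferInstance, inferInstance, φ.codRestrict _ fun a => ?_, ?_, fun a => ⟨_, hφ a⟩, ?_⟩
    · change (φ a).val.BlockTriangular D.b
      rw [hφ]
      exact blockTriangular_one_add_vecMulVec (fun i hi => extendBlock_apply_of_ne _ hi) hμj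
    · intro a a' h
      have h1 : φ a = φ a' := congrArg Subtype.val h
      refine hf ?_
      have h2 := vecMulVec_left_injective hμ
        (add_left_cancel ((hφ a).symm.trans ((congrArg Units.val h1).trans (hφ a'))))
      ext i
      rw [← extendBlock_apply (f a), h2, extendBlock_apply]
    · refine D.sum_inflation_eq_zero _ j (fun a i hi => Units.ext ?_) (hsum _ fun a => ?_)
      · change (φ a).val.toSquareBlock D.b i = 1
        rw [hφ, toSquareBlock_one_add_vecMulVec]
        ext ⟨x, hx⟩ y
        simp [Matrix.vecMulVec_apply, extendBlock_apply_of_ne (f a) (fun h => hi (hx ▸ h))]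
      · change (φ a).val.toSquareBlock D.b j = _
        rw [hφ, toSquareBlock_one_add_vecMulVec]
        simp only [extendBlock_apply]
        rfl
  -- In size 1 no non-zero `v` in the block is killed by `μ`, so dilations replace transvections.
  by_cases hcard : Fintype.card {i // D.b i = j} = 1
  · let v' : {i // D.b i = j} → k := fun _ => (μ i₀)⁻¹
    obtain ⟨i₁, hi₁⟩ := Fintype.card_eq_one_iff.1 hcard
    have hv' : μ' ⬝ᵥ v' = 1 := by
      rw [dotProduct, Fintype.sum_eq_single ⟨i₀, hj⟩ fun i hi =>
        absurd ((hi₁ i).trans (hi₁ _).symm) hi]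
      exact mul_inv_cancel₀ hi₀
    refine key kˣ (dilationHom (extendBlock D.b j v') μ ((dotProduct_extendBlock _ _ _ _).trans hv'))
      (fun t => ((t : k) - 1) • v') (fun t => ?_) (fun t t' h => ?_) (fun g hg w => ?_)
    · rw [dilationHom_coe]
      congr 2
      ext i
      by_cases h : D.b i = j <;> simp [extendBlock, h]
    · have := congrFun h ⟨i₀, hj⟩
      simp only [Pi.smul_apply, smul_eq_mul, v'] at this
      exact Units.ext (sub_left_injective (mul_right_cancel₀ (inv_ne_zero hi₀) this))
    · rw [← sum_scalar_eq_zero (D.irreducible j) hcard (fun h => hD ⟨j, hcard, h⟩) w]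
      refine Finset.sum_congr rfl fun t _ => ?_
      congr 2
      refine Units.ext ?_
      rw [hg]
      ext x y
      obtain rfl : x = y := (hi₁ x).trans (hi₁ y).symm
      obtain rfl : x = ⟨i₀, hj⟩ := (hi₁ x).trans (hi₁ _).symm
      have : (μ i₀)⁻¹ * μ i₀ = 1 := inv_mul_cancel₀ hi₀
      simp [Matrix.vecMulVec_apply, v', μ', this]
  · have hnt : Nontrivial {i // D.b i = j} := by
      have : 0 < Fintype.card {i // D.b i = j} := Fintype.card_pos_iff.2 ⟨⟨i₀, hj⟩⟩
      exact Fintype.one_lt_card_iff_nontrivial.1 (by omega)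
    let K : AddSubgroup ({i // D.b i = j} → k) :=
      { carrier := {v | μ' ⬝ᵥ v = 0}
        add_mem' := fun {v w} hv hw => by
          rw [Set.mem_ofPred_eq] at hv hw ⊢
          rw [dotProduct_add, hv, hw, add_zero]
        zero_mem' := dotProduct_zero _
        neg_mem' := fun {v} hv => by
          rw [Set.mem_ofPred_eq] at hv ⊢
          rw [dotProduct_neg, hv, neg_zero] }
    let _ : Fintype K := Fintype.ofFinite K
    refine key (Multiplicative K) (transvectionHom ((extendBlock D.b j).comp K.subtype) μ
      fun a => (dotProduct_extendBlock _ _ _ _).trans a.2) (fun a => a.toAdd.1) (fun a => rfl)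
      (fun a a' h => Subtype.ext h) (fun g hg w => ?_)
    rw [← (D.cuspidal j).sum_transvection_eq_zero hnt K.subtype hμ' (fun a => a.2)
      (fun v hv => ⟨⟨v, hv⟩, rfl⟩) w]
    refine Finset.sum_congr rfl fun a _ => ?_
    congr 2
    exact Units.ext (hg a)

end Inflation

/-! ### Fourier operators and the functional equations. -/

section FunctionalEquation

variable {R : Type u} [Field R] {k : Type v} [Field k] [Fintype k] [DecidableEq k] {n : ℕ}
  {V : Type w} [AddCommGroup V] [Module R V] {π : Representation R (GL (Fin n) k) V}

/-- The operator in the Fourier transform at a singular matrix vanishes. -/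
theorem CuspidalDatum.sum_addChar_trace_eq_zero (D : CuspidalDatum R k n)
    (hD : D.ContainsTrivial → ((Fintype.card k - 1 : ℕ) : R) = 0) (hπ : D.IsCuspidalSupportOf π)
    (ψ : AddChar k R) {x : Matrix (Fin n) (Fin n) k} (hx : ¬ IsUnit x) (v : V) :
    ∑ g : GL (Fin n) k, ψ (Matrix.trace (x * g.val)) • π g⁻¹ v = 0 := by
  obtain ⟨F, hF⟩ := hπ
  obtain ⟨f, rfl⟩ := hF v
  simp_rw [← F.isIntertwining, ← map_smul, ← map_sum]
  refine (congrArg F ?_).trans (map_zero F)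
  refine Subtype.ext (funext fun h => ?_)
  rw [← Equiv.sum_comp (Equiv.inv _)]
  simp only [Equiv.inv_apply, inv_inv]
  have e1 : ((∑ g : GL (Fin n) k, ψ (Matrix.trace (x * (g⁻¹).val)) • D.parabolicInduction g f :
      Representation.coindV (parabolic k D.b).subtype D.inflation) : GL (Fin n) k → _) h =
      ∑ g : GL (Fin n) k, ψ (Matrix.trace (x * (g⁻¹).val)) • f.1 (h * g) := by
    simp only [Submodule.coe_sum, Finset.sum_apply]
    rfl
  simp only [map_smul]
  rw [e1, ← Equiv.sum_comp (Equiv.mulLeft h⁻¹)]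
  simp only [Equiv.coe_mulLeft, mul_inv_cancel_left, mul_inv_rev, inv_inv, Units.val_mul]
  have hdet : (h.val * x).det = 0 := by
    rw [Matrix.det_mul]
    rw [Matrix.isUnit_iff_isUnit_det, isUnit_iff_ne_zero, not_not] at hx
    rw [hx, mul_zero]
  -- Along the cosets of the group attached to `μ` the `ψ`-factor is constant, while `f` transforms
  -- by the inflation, whose sum is zero.
  obtain ⟨μ, hμ, hμx⟩ := Matrix.exists_vecMul_eq_zero_iff.2 hdet
  obtain ⟨A, _, _, φ, hφ, hφμ, hsum⟩ := D.exists_sum_inflation_eq_zero hD hμ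
  refine sum_eq_zero_of_sum_coset ((parabolic k D.b).subtype.comp φ)
    ((parabolic k D.b).subtype_injective.comp hφ) _ fun g => ?_
  have e2 : ∀ a, ψ (Matrix.trace (x * (((((parabolic k D.b).subtype.comp φ) a * g)⁻¹ :
      GL (Fin n) k).val * h.val))) • f.1 (((parabolic k D.b).subtype.comp φ) a * g) =
      ψ (Matrix.trace (h.val * x * (g⁻¹).val)) • D.inflation (φ a) (f.1 g) := by
    intro a
    have e3 : (φ a).1.val * (h.val * x) = h.val * x := by
      obtain ⟨v, hv⟩ := hφμ a
      rw [hv, add_mul, one_mul, Matrix.vecMulVec_mul, hμx]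
      simp
    have e4 : ((φ a).1⁻¹).val * (h.val * x) = h.val * x := by
      conv_lhs => rw [← e3]
      rw [← mul_assoc, ← Units.val_mul, inv_mul_cancel, Units.val_one, one_mul]
    congr 1
    · congr 1
      rw [mul_inv_rev, Units.val_mul, ← mul_assoc, Matrix.trace_mul_comm, ← mul_assoc, ← mul_assoc,
        Matrix.trace_mul_comm, ← mul_assoc]
      exact congrArg Matrix.trace (congrArg (· * _) e4)
    · exact f.2 (φ a) g
  rw [Finset.sum_congr rfl fun a _ => e2 a, ← Finset.smul_sum, ← LinearMap.sum_apply, hsum,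
    LinearMap.zero_apply, smul_zero]

theorem zetaSum_fourier (s : R) (ψ : AddChar k R) (π : Representation R (GL (Fin n) k) V)
    (Φ : Matrix (Fin n) (Fin n) k → R) (v : V) (v' : Module.Dual R V) :
    zetaSum (fourier s ψ Φ) (invArg (matrixCoeff π v v')) = s⁻¹ * ∑ x, Φ x *
      v' (∑ g : GL (Fin n) k, ψ (Matrix.trace (x * g.val)) • π g⁻¹ v) := by
  simp only [zetaSum, fourier, invArg, matrixCoeff, map_sum, map_smul, smul_eq_mul, Finset.mul_sum,
    Finset.sum_mul]
  rw [Finset.sum_comm]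
  refine Finset.sum_congr rfl fun x _ => Finset.sum_congr rfl fun g _ => ?_
  ring

/-- An irreducible representation of a finite group is finite dimensional. -/
theorem finiteDimensional_of_isIrreducible {G : Type*} [Group G] [Finite G]
    {π : Representation R G V} (hπ : π.IsIrreducible) : FiniteDimensional R V := by
  by_cases hV : ∃ v : V, v ≠ 0
  · obtain ⟨v, hv⟩ := hV
    rcases eq_bot_or_eq_top_of_invariant hπ (Submodule.span R (Set.range fun g => π g v))
      (fun g w hw => by
        refine Submodule.span_induction (fun x ⟨h, hx⟩ => ?_) (by simp) (fun x y _ _ hx hy => ?_)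
          (fun c x _ hx => ?_) hw
        · rw [← hx]
          exact Submodule.subset_span ⟨g * h, by simp⟩
        · rw [map_add]
          exact add_mem hx hy
        · rw [map_smul]
          exact Submodule.smul_mem _ _ hx) with h | h
    · refine absurd ?_ hv
      rw [← Submodule.mem_bot R, ← h]
      exact Submodule.subset_span ⟨1, by simp⟩
    · exact ⟨h ▸ Submodule.fg_span (Set.finite_range _)⟩
  · push Not at hV
    have : Subsingleton V := ⟨fun x y => (hV x).trans (hV y).symm⟩
    infer_instance

/-- The operator at `x = 1` commutes with `π` since the trace is invariant under conjugation;
Schur's lemma makes it a scalar, and translation by `x` does the rest. -/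
theorem exists_sum_addChar_trace_eq_smul [IsAlgClosed R] (hπ : π.IsIrreducible)
    (ψ : AddChar k R) : ∃ c : R, ∀ (x : GL (Fin n) k) (v : V),
      ∑ g : GL (Fin n) k, ψ (Matrix.trace (x.val * g.val)) • π g⁻¹ v = c • π x v := by
  have := finiteDimensional_of_isIrreducible hπ
  have hcomm : ∀ h : GL (Fin n) k,
      (∑ g : GL (Fin n) k, ψ (Matrix.trace g.val) • π g⁻¹) ∘ₗ π h =
        π h ∘ₗ ∑ g : GL (Fin n) k, ψ (Matrix.trace g.val) • π g⁻¹ := by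
    intro h
    ext v
    simp only [LinearMap.comp_apply, LinearMap.sum_apply, LinearMap.smul_apply, map_sum, map_smul,
      ← Module.End.mul_apply, ← map_mul]
    refine Fintype.sum_equiv (MulAut.conj h⁻¹).toEquiv _ _ fun g => ?_
    congr 2
    · simp only [MulEquiv.toEquiv_eq_coe, MulEquiv.coe_toEquiv, MulAut.conj_apply, Units.val_mul]
      rw [Matrix.trace_mul_comm, ← mul_assoc, ← Units.val_mul]
      simp
    · simp [mul_assoc]
  obtain ⟨c, hc⟩ := (Representation.IsIrreducible.algebraMap_intertwiningMap_bijective_of_isAlgClosed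
    (ρ := π)).2 ⟨_, hcomm⟩
  refine ⟨c, fun x v => ?_⟩
  have h1 : ∑ g : GL (Fin n) k, ψ (Matrix.trace g.val) • π g⁻¹ (π x v) = c • π x v := by
    have := congrArg (fun T => T.toLinearMap (π x v)) hc
    simp only [LinearMap.sum_apply, LinearMap.smul_apply] at this
    rw [← this]
    rfl
  rw [← h1]
  refine Fintype.sum_equiv (Equiv.mulLeft x) _ _ fun g => ?_
  simp [← Module.End.mul_apply, ← map_mul]

/-- If the operators in the Fourier transform vanish at the singular points of the support of `Φ`,
then the functional equation for `Φ` holds. -/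
theorem exists_functionalEquation [IsAlgClosed R] (hπ : π.IsIrreducible) (s : R)
    (ψ : AddChar k R) : ∃ γ : R, ∀ (Φ : Matrix (Fin n) (Fin n) k → R) (v : V)
      (v' : Module.Dual R V), (∀ x, ¬ IsUnit x → Φ x = 0 ∨
        ∑ g : GL (Fin n) k, ψ (Matrix.trace (x * g.val)) • π g⁻¹ v = 0) →
      zetaSum (fourier s ψ Φ) (invArg (matrixCoeff π v v')) =
        γ * zetaSum Φ (matrixCoeff π v v') := by
  obtain ⟨c, hc⟩ := exists_sum_addChar_trace_eq_smul hπ ψ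
  refine ⟨s⁻¹ * c, fun Φ v v' h => ?_⟩
  rw [zetaSum_fourier, mul_assoc]
  congr 1
  rw [zetaSum, Finset.mul_sum]
  symm
  refine Fintype.sum_of_injective (fun g : GL (Fin n) k => g.val) Units.val_injective _ _
    (fun x hx => ?_) fun x => ?_
  · rcases h x (fun hu => hx hu) with h | h
    · rw [h, zero_mul]
    · rw [h, map_zero, mul_zero]
  · rw [hc, map_smul, matrixCoeff, smul_eq_mul]
    ring

theorem weakFE_of_isIrreducible [IsAlgClosed R] (hπ : π.IsIrreducible) (s : R) : WeakFE s π :=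
  fun ψ _ => (exists_functionalEquation hπ s ψ).imp fun _ h Φ hΦ v v' =>
    h Φ v v' fun x hx => Or.inl (hΦ x hx)

theorem CuspidalDatum.strongFE [IsAlgClosed R] (D : CuspidalDatum R k n) (hπ : π.IsIrreducible)
    (hD : D.ContainsTrivial → ((Fintype.card k - 1 : ℕ) : R) = 0) (hDπ : D.IsCuspidalSupportOf π)
    (s : R) : StrongFE s π :=
  fun ψ _ => (exists_functionalEquation hπ s ψ).imp fun _ h Φ v v' =>
    h Φ v v' fun _ hx => Or.inr (D.sum_addChar_trace_eq_zero hD hDπ ψ hx v)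

end FunctionalEquation

/-! ### Irreducible constituents for a product of groups. -/

section TensorDecomposition

variable {R : Type u} [Field R]

theorem isIrreducible_of_invariant {G V : Type*} [Group G] [AddCommGroup V] [Module R V]
    [Nontrivial V] {ρ : Representation R G V}
    (h : ∀ W : Submodule R V, (∀ g, ∀ v ∈ W, ρ g v ∈ W) → W = ⊥ ∨ W = ⊤) : ρ.IsIrreducible := by
  refine @IsSimpleOrder.mk _ _ _ ⟨⊥, ⊤, fun hbt => ?_⟩ fun S => ?_
  · exact bot_ne_top (congrArg Subrepresentation.toSubmodule hbt : (⊥ : Submodule R V) = ⊤)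
  · exact (h S.toSubmodule fun g v hv => S.apply_mem_toSubmodule g hv).imp
      (fun h => Subrepresentation.toSubmodule_injective h)
      fun h => Subrepresentation.toSubmodule_injective h

/-- Transport of a representation along a linear equivalence. -/
def transport {G V W : Type*} [Group G] [AddCommGroup V] [Module R V] [AddCommGroup W] [Module R W]
    (ρ : Representation R G V) (e : V ≃ₗ[R] W) : Representation R G W where
  toFun g := e.toLinearMap ∘ₗ ρ g ∘ₗ e.symm.toLinearMap
  map_one' := by ext; simp
  map_mul' g h := by ext; simp

theorem transport_apply {G V W : Type*} [Group G] [AddCommGroup V] [Module R V] [AddCommGroup W]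
    [Module R W] (ρ : Representation R G V) (e : V ≃ₗ[R] W) (g : G) (w : W) :
    transport ρ e g w = e (ρ g (e.symm w)) := rfl

/-- A non-zero finite dimensional representation contains an irreducible one. -/
theorem exists_irreducible_sub {G M : Type*} [Group G] [AddCommGroup M] [Module R M]
    [FiniteDimensional R M] [Nontrivial M] (τ : Representation R G M) :
    ∃ (d : ℕ) (ρ : Representation R G (Fin d → R)) (f : (Fin d → R) →ₗ[R] M),
      ρ.IsIrreducible ∧ f ≠ 0 ∧ ∀ g w, f (ρ g w) = τ g (f w) := by
  -- A non-zero invariant subspace of least dimension is irreducible.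
  obtain ⟨S, hS, hmin⟩ := WellFounded.has_min
    (measure fun S : Submodule R M => Module.finrank R S).wf
    {S | S ≠ ⊥ ∧ ∀ g, ∀ v ∈ S, τ g v ∈ S} ⟨⊤, top_ne_bot, fun _ _ _ => trivial⟩
  obtain ⟨hS0, hSinv⟩ := hS
  let e : S ≃ₗ[R] (Fin (Module.finrank R S) → R) := (Module.finBasis R S).equivFun
  let σ : Representation R G S := (Subrepresentation.mk S fun g v hv => hSinv g v hv).toRepresentation
  have : Nontrivial S := Submodule.nontrivial_iff_ne_bot.2 hS0
  have : Nontrivial (Fin (Module.finrank R S) → R) := e.symm.toEquiv.nontrivial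
  let f : (Fin (Module.finrank R S) → R) →ₗ[R] M := S.subtype ∘ₗ e.symm.toLinearMap
  have hfinj : Function.Injective f := S.subtype_injective.comp e.symm.injective
  have hf : ∀ g w, f (transport σ e g w) = τ g (f w) := fun g w => by
    simp only [f, LinearMap.comp_apply, transport_apply, LinearEquiv.coe_coe,
      LinearEquiv.symm_apply_apply]
    rfl
  refine ⟨_, transport σ e, f, isIrreducible_of_invariant fun W hW => ?_, fun h0 => ?_, hf⟩
  · by_cases hWb : W = ⊥
    · exact Or.inl hWb
    · right
      have h1 := hmin (W.map f) ⟨fun h => hWb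
        (Submodule.map_injective_of_injective hfinj (h.trans (Submodule.map_bot f).symm)), ?_⟩
      · have h2 : ¬ Module.finrank R (W.map f) < Module.finrank R S := h1
        rw [← (Submodule.equivMapOfInjective f hfinj W).finrank_eq, not_lt] at h2
        exact Submodule.eq_top_of_finrank_eq
          (le_antisymm (Submodule.finrank_le W) (e.finrank_eq.symm.le.trans h2))
      · rintro g _ ⟨w, hw, rfl⟩
        exact ⟨_, hW g w hw, hf g w⟩
  · obtain ⟨w, hw⟩ := exists_ne (0 : Fin (Module.finrank R S) → R)
    exact hw (hfinj (by rw [h0]; simp))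

/-- A non-zero finite dimensional representation of a finite product of groups receives a non-zero
equivariant multilinear map from irreducible representations of the factors. -/
theorem exists_equivariant_multilinearMap (r : ℕ) : ∀ (L : Fin r → Type v) [∀ i, Group (L i)]
    (M : Type u) [AddCommGroup M] [Module R M] [FiniteDimensional R M] [Nontrivial M]
    (τ : Representation R (∀ i, L i) M),
    ∃ (d : Fin r → ℕ) (ρ : ∀ i, Representation R (L i) (Fin (d i) → R))
      (m : MultilinearMap R (fun i => Fin (d i) → R) M),
      (∀ i, (ρ i).IsIrreducible) ∧ m ≠ 0 ∧ ∀ g w, m (fun i => ρ i (g i) (w i)) = τ g (m w) := by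
  induction r with
  | zero =>
    intro L _ M _ _ _ _ τ
    obtain ⟨x, hx⟩ := exists_ne (0 : M)
    refine ⟨fun i => i.elim0, fun i => i.elim0, MultilinearMap.constOfIsEmpty R _ x,
      fun i => i.elim0, fun h => hx ?_, fun g w => ?_⟩
    · exact congrArg (fun m => m fun i => i.elim0) h
    · rw [Subsingleton.elim g 1, map_one]
      rfl
  | succ r ih =>
    intro L _ M _ _ _ _ τ
    obtain ⟨d₀, ρ₀, f, hρ₀, hf0, hf⟩ := exists_irreducible_sub (τ.comp (MonoidHom.mulSingle L 0))
    let c : (∀ i : Fin r, L i.succ) →* ∀ i, L i :=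
      { toFun := fun g => Fin.cons 1 g
        map_one' := by ext i; refine Fin.cases ?_ (fun i => ?_) i <;> simp
        map_mul' := fun g h => by ext i; refine Fin.cases ?_ (fun i => ?_) i <;> simp }
    have hc : ∀ x g, MonoidHom.mulSingle L 0 x * c g = Fin.cons x g := by
      intro x g
      ext i
      refine Fin.cases ?_ (fun i => ?_) i <;> simp [c]
    have hc' : ∀ x g, c g * MonoidHom.mulSingle L 0 x = Fin.cons x g := by
      intro x g
      ext i
      refine Fin.cases ?_ (fun i => ?_) i <;> simp [c]
    -- The other factors commute with the first, so they act by postcomposition on the space of maps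
    -- equivariant for the first; induction applies to that action.
    let H : Submodule R ((Fin d₀ → R) →ₗ[R] M) :=
      { carrier := {T | ∀ g w, T (ρ₀ g w) = τ (MonoidHom.mulSingle L 0 g) (T w)}
        add_mem' := fun {S T} hS hT g w => by simp [hS g w, hT g w]
        zero_mem' := fun g w => by simp
        smul_mem' := fun a T hT g w => by simp [hT g w] }
    let τ' : Representation R (∀ i : Fin r, L i.succ) H :=
      { toFun := fun g => LinearMap.restrict (LinearMap.compRight R (τ (c g)))
          (fun T (hT : T ∈ H) x w => by
            simp only [LinearMap.compRight_apply, LinearMap.comp_apply]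
            rw [hT, ← Module.End.mul_apply, ← Module.End.mul_apply, ← map_mul, ← map_mul, hc, hc'])
        map_one' := by ext; simp
        map_mul' := fun g h => by ext; simp }
    have : Nontrivial H := ⟨⟨f, hf⟩, 0, fun h => hf0 (congrArg Subtype.val h)⟩
    obtain ⟨d', ρ', m', hρ', hm'0, hm'⟩ := ih (fun i => L i.succ) H τ'
    let mm : (Fin d₀ → R) →ₗ[R] MultilinearMap R (fun i => Fin (d' i) → R) M :=
      { toFun := fun w => ((LinearMap.applyₗ w) ∘ₗ H.subtype).compMultilinearMap m'
        map_add' := fun w w' => by ext; simp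
        map_smul' := fun a w => by ext; simp }
    let d : Fin (r + 1) → ℕ := Fin.cons d₀ d'
    let m : MultilinearMap R (fun i => Fin (d i) → R) M :=
      LinearMap.uncurryLeft (M := fun i => Fin (d i) → R) mm
    have hm : ∀ w, m w = (m' (fun i => w i.succ)).1 (w 0) := fun w => rfl
    refine ⟨d, Fin.cases ρ₀ ρ', m, Fin.cases hρ₀ hρ', fun h => ?_, fun g w => ?_⟩
    · refine hm'0 (MultilinearMap.ext fun w => Subtype.ext (LinearMap.ext fun w₀ => ?_))
      exact (hm (Fin.cons w₀ w : ∀ i, Fin (d i) → R)).symm.trans (by rw [h]; rfl)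
    · rw [hm, hm]
      have h1 := hm' (fun i => g i.succ) (fun i => w i.succ)
      have h2 := (m' (fun i => w i.succ)).2 (g 0) (w 0)
      have h3 : g = c (fun i => g i.succ) * MonoidHom.mulSingle L 0 (g 0) := by
        rw [hc']
        exact (Fin.cons_self_tail g).symm
      rw [h3, map_mul, Module.End.mul_apply, ← h2, ← h3]
      exact congrArg (fun T : H => T.1 (ρ₀ (g 0) (w 0))) h1

end TensorDecomposition

/-! ### Levi factors and the order of the unipotent radical. -/

section Levi

variable {k ι α : Type*} [Field k] [Fintype ι] [DecidableEq ι] [LinearOrder α]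

/-- The block diagonal matrix with given diagonal blocks. -/
def blockDiag (b : ι → α) (g : ∀ a, Matrix {i // b i = a} {i // b i = a} k) : Matrix ι ι k :=
  fun i j => if h : b j = b i then g (b i) ⟨i, rfl⟩ ⟨j, h⟩ else 0

theorem blockDiag_apply {b : ι → α} (g : ∀ a, Matrix {i // b i = a} {i // b i = a} k) {a : α}
    {i j : ι} (hi : b i = a) (hj : b j = a) : blockDiag b g i j = g a ⟨i, hi⟩ ⟨j, hj⟩ := by
  subst hi
  simp [blockDiag, hj]

theorem blockDiag_apply_of_ne {b : ι → α} (g : ∀ a, Matrix {i // b i = a} {i // b i = a} k)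
    {i j : ι} (h : b j ≠ b i) : blockDiag b g i j = 0 := by
  simp [blockDiag, h]

theorem blockDiag_one (b : ι → α) :
    blockDiag b (fun _ => 1) = (1 : Matrix ι ι k) := by
  ext i j
  by_cases h : b j = b i
  · rw [blockDiag_apply _ rfl h]
    simp [Matrix.one_apply]
  · rw [blockDiag_apply_of_ne _ h, Matrix.one_apply_ne]
    rintro rfl
    exact h rfl

theorem blockDiag_mul (b : ι → α) (g h : ∀ a, Matrix {i // b i = a} {i // b i = a} k) :
    blockDiag b (fun a => g a * h a) = blockDiag b g * blockDiag b h := by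
  ext i j
  rw [Matrix.mul_apply]
  by_cases hij : b j = b i
  · rw [blockDiag_apply _ rfl hij, Matrix.mul_apply]
    refine Fintype.sum_of_injective Subtype.val Subtype.val_injective _ _ (fun l hl => ?_)
      fun l => ?_
    · rw [blockDiag_apply_of_ne g fun h => hl ⟨⟨l, h⟩, rfl⟩, zero_mul]
    · rw [blockDiag_apply g rfl l.2, blockDiag_apply h l.2 hij]
  · rw [blockDiag_apply_of_ne _ hij]
    refine (Finset.sum_eq_zero fun l _ => ?_).symm
    by_cases hl : b l = b i
    · rw [blockDiag_apply_of_ne h fun h => hij (h.trans hl), mul_zero]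
    · rw [blockDiag_apply_of_ne g hl, zero_mul]

/-- The section of the projection onto the Levi factor given by block diagonal matrices. -/
noncomputable def leviHom (b : ι → α) : (∀ a, GL {i // b i = a} k) →* GL ι k :=
  MonoidHom.toHomUnits
    { toFun := fun g => blockDiag b fun a => (g a).val
      map_one' := blockDiag_one b
      map_mul' := fun g h => blockDiag_mul b _ _ }

theorem leviHom_coe (b : ι → α) (g : ∀ a, GL {i // b i = a} k) :
    (leviHom b g).val = blockDiag b fun a => (g a).val := rfl

theorem leviHom_mem_parabolic (b : ι → α) (g : ∀ a, GL {i // b i = a} k) :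
    leviHom b g ∈ parabolic k b :=
  fun _ _ h => blockDiag_apply_of_ne (fun a => (g a).val) h.ne

theorem leviProj_leviHom (b : ι → α) (g : ∀ a, GL {i // b i = a} k) :
    leviProj b ⟨leviHom b g, leviHom_mem_parabolic b g⟩ = g := by
  refine funext fun a => Units.ext ?_
  ext i j
  exact blockDiag_apply (fun a => (g a).val) i.2 j.2

theorem conj_mem_unipotentRadical {b : ι → α} {p u : GL ι k} (hp : p ∈ parabolic k b)
    (hu : u ∈ unipotentRadical k b) : p⁻¹ * u * p ∈ unipotentRadical k b := by
  obtain ⟨u, hu, rfl⟩ := hu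
  lift p to parabolic k b using hp
  refine Subgroup.mem_map.2 ⟨p⁻¹ * u * p, ?_, rfl⟩
  rw [SetLike.mem_coe, MonoidHom.mem_ker] at hu
  rw [MonoidHom.mem_ker, map_mul, map_mul, hu, mul_one, ← map_mul, inv_mul_cancel, map_one]

theorem leviHom_inv_mul_mem_unipotentRadical {b : ι → α} (p : parabolic k b) :
    (leviHom b (leviProj b p))⁻¹ * p.1 ∈ unipotentRadical k b := by
  refine Subgroup.mem_map.2 ⟨⟨_, leviHom_mem_parabolic b (leviProj b p)⟩⁻¹ * p, ?_, rfl⟩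
  rw [MonoidHom.mem_ker, map_mul, map_inv, leviProj_leviHom, inv_mul_cancel]

/-- The unipotent radical has the cardinality of a vector space over `k`. -/
theorem exists_card_unipotentRadical [Fintype k] (b : ι → α) :
    ∃ N : ℕ, Nat.card (unipotentRadical k b) = Fintype.card k ^ N := by
  classical
  let X := {x : ι × ι // b x.1 < b x.2}
  let A : (X → k) → Matrix ι ι k := fun f i j =>
    if h : b i < b j then f ⟨(i, j), h⟩ else (1 : Matrix ι ι k) i j
  have hA1 : ∀ f i j, b j ≤ b i → A f i j = (1 : Matrix ι ι k) i j := fun f i j h =>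
    dif_neg (not_lt.2 h)
  have hA : ∀ f, IsUnit (A f).det := fun f => by
    have hbt : (A f).BlockTriangular b := fun i j h => by
      rw [hA1 f i j h.le, Matrix.one_apply_ne]
      rintro rfl
      exact lt_irrefl _ h
    rw [hbt.det, Finset.prod_eq_one]
    · exact isUnit_one
    · intro a _
      have : (A f).toSquareBlock b a = 1 := by
        rw [← toSquareBlock_one b a]
        ext i j
        exact hA1 f i j (by rw [i.2, j.2])
      rw [this, Matrix.det_one]
  let e : unipotentRadical k b ≃ (X → k) :=
    { toFun := fun u x => u.1.val x.1.1 x.1.2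
      invFun := fun f => ⟨Matrix.GeneralLinearGroup.mk'' (A f) (hA f),
        mem_unipotentRadical_iff.2 (hA1 f)⟩
      left_inv := fun u => by
        refine Subtype.ext (Units.ext ?_)
        ext i j
        change A (fun x => u.1.val x.1.1 x.1.2) i j = u.1.val i j
        by_cases h : b i < b j
        · simp [A, h]
        · exact (hA1 (fun x => u.1.val x.1.1 x.1.2) i j (not_lt.1 h)).trans
            (mem_unipotentRadical_iff.1 u.2 i j (not_lt.1 h)).symm
      right_inv := fun f => by
        ext ⟨⟨i, j⟩, h⟩
        change A f i j = _
        simp only [A]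
        rw [dif_pos h] }
  exact ⟨Fintype.card X, by rw [Nat.card_congr e, Nat.card_eq_fintype_card, Fintype.card_fun]⟩

end Levi

/-! ### From coinvariants to invariants, and reordering of blocks. -/

section Invariants

variable {R G V : Type*} [Field R] [Group G] [AddCommGroup V] [Module R V]

/-- If a finite group of order invertible in `R` has non-zero coinvariants, then it, or a conjugate,
has non-zero invariants. -/
theorem exists_invariant_of_coinvariants (ρ : Representation R G V) (U : Subgroup G) [Finite U]
    (hU : (Nat.card U : R) ≠ 0) (x : G)
    (h : ¬ Subsingleton (Representation.Coinvariants
      (ρ.comp (U.map (MulAut.conj x).toMonoidHom).subtype))) :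
    ∃ w, w ≠ 0 ∧ ∀ u ∈ U, ρ u w = w := by
  have := Fintype.ofFinite U
  by_contra! hinv
  refine h ⟨fun y z => ?_⟩
  have hmk : ∀ w, Representation.Coinvariants.mk
      (ρ.comp (U.map (MulAut.conj x).toMonoidHom).subtype) w = 0 := by
    intro w
    -- The sum over `U` is `U`-invariant, hence zero; conjugated by `x`, its class in the
    -- coinvariants is `|U|` times that of `w`.
    have h1 : ∑ u : U, ρ u (ρ x⁻¹ w) = 0 := by
      by_contra h0
      obtain ⟨u, hu, hne⟩ := hinv _ h0
      refine hne ?_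
      rw [map_sum]
      refine Fintype.sum_equiv (Equiv.mulLeft ⟨u, hu⟩) _ _ fun a => ?_
      simp
    have h2 : ∑ u : U, ρ (x * u * x⁻¹) w = 0 := by
      rw [← map_zero (ρ x), ← h1, map_sum]
      simp
    have h3 := congrArg (Representation.Coinvariants.mk
      (ρ.comp (U.map (MulAut.conj x).toMonoidHom).subtype)) h2
    have h4 : ∀ u : U, Representation.Coinvariants.mk
        (ρ.comp (U.map (MulAut.conj x).toMonoidHom).subtype) (ρ (x * u * x⁻¹) w) =
        Representation.Coinvariants.mk _ w := fun u =>
      Representation.Coinvariants.mk_self_apply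
        (ρ.comp (U.map (MulAut.conj x).toMonoidHom).subtype) ⟨_, u.1, u.2, rfl⟩ w
    rw [map_sum, map_zero, Finset.sum_congr rfl fun u _ => h4 u, Finset.sum_const,
      Finset.card_univ, ← Nat.card_eq_fintype_card, ← Nat.cast_smul_eq_nsmul R] at h3
    exact (smul_eq_zero.1 h3).resolve_left hU
  obtain ⟨y, rfl⟩ := Representation.Coinvariants.mk_surjective _ y
  obtain ⟨z, rfl⟩ := Representation.Coinvariants.mk_surjective _ z
  rw [hmk, hmk]

end Invariants

section Sorting

variable {R : Type u} [Field R] {k : Type v} [Field k] {n : ℕ}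
  {V : Type w} [AddCommGroup V] [Module R V]

/-- Every labelling of `Fin n` factors, up to a permutation, through a monotone surjection onto
`Fin r`. -/
theorem exists_sorted (b : Fin n → ℕ) : ∃ (c : Fin n → Fin (Finset.univ.image b).card)
    (σ : Equiv.Perm (Fin n)), Monotone c ∧ Function.Surjective c ∧
      ∀ i j, c i ≤ c j ↔ b (σ i) ≤ b (σ j) := by
  let e := (Finset.univ.image b).orderIsoOfFin rfl
  let σ := Tuple.sort b
  have hc : ∀ i j, e.symm ⟨b (σ i), by simp⟩ ≤ e.symm ⟨b (σ j), by simp⟩ ↔ b (σ i) ≤ b (σ j) :=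
    fun i j => by rw [OrderIso.le_iff_le, Subtype.mk_le_mk]
  refine ⟨fun i => e.symm ⟨b (σ i), by simp⟩, σ, fun i j h => (hc i j).2 (Tuple.monotone_sort b h),
    fun a => ?_, hc⟩
  obtain ⟨i, -, hi⟩ := Finset.mem_image.1 (e a).2
  refine ⟨σ.symm i, ?_⟩
  rw [OrderIso.symm_apply_eq]
  exact Subtype.ext (by simpa using hi)

theorem exists_invariant_of_perm (π : Representation R (GL (Fin n) k) V) {α β : Type*}
    [LinearOrder α] [LinearOrder β] {b : Fin n → α} {c : Fin n → β} (σ : Equiv.Perm (Fin n))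
    (h : ∀ i j, c i ≤ c j ↔ b (σ i) ≤ b (σ j))
    (hb : ∃ x, x ≠ 0 ∧ ∀ u ∈ unipotentRadical k b, π u x = x) :
    ∃ x, x ≠ 0 ∧ ∀ u ∈ unipotentRadical k c, π u x = x := by
  obtain ⟨x, hx, hinv⟩ := hb
  -- The permutation matrix of `σ`, which conjugates the radical of `c` into that of `b`.
  let Q : GL (Fin n) k :=
    { val := (1 : Matrix (Fin n) (Fin n) k).submatrix σ.symm id
      inv := (1 : Matrix (Fin n) (Fin n) k).submatrix id σ.symm
      val_inv := by
        rw [← Matrix.submatrix_mul _ _ _ id _ Function.bijective_id, one_mul,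
          Matrix.submatrix_one_equiv]
      inv_val := by
        rw [← Matrix.submatrix_mul _ _ _ _ _ σ.symm.bijective, one_mul, Matrix.submatrix_id_id] }
  refine ⟨π Q⁻¹ x, fun h0 => hx ?_, fun u hu => ?_⟩
  · rw [← one_smul R x]
    have := congrArg (π Q) h0
    rwa [← Module.End.mul_apply, ← map_mul, mul_inv_cancel, map_one, map_zero,
      Module.End.one_apply, ← one_smul R x] at this
  · have h1 : Q * u * Q⁻¹ ∈ unipotentRadical k b := by
      rw [mem_unipotentRadical_iff] at hu ⊢
      intro i j hij
      have h2 : (Q * u * Q⁻¹).val i j = u.val (σ.symm i) (σ.symm j) := by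
        change (Q.val * u.val * Q.inv) i j = _
        simp [Q, Matrix.mul_apply, Matrix.one_apply]
      rw [h2, hu _ _ ((h _ _).2 (by simpa using hij))]
      simp [Matrix.one_apply]
    calc π u (π Q⁻¹ x) = π Q⁻¹ (π (Q * u * Q⁻¹) x) := by
          simp only [← Module.End.mul_apply, ← map_mul]
          simp [mul_assoc]
      _ = π Q⁻¹ x := by rw [hinv _ h1]

end Sorting

/-! ### Frobenius reciprocity. -/

section Frobenius

variable {R : Type u} [Field R] {G : Type*} [Group G] [Finite G] {P : Subgroup G} {W V : Type*}
  [AddCommGroup W] [Module R W] [AddCommGroup V] [Module R V]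

/-- Frobenius reciprocity for representations of a finite group: an irreducible representation `π`
that receives a non-zero `P`-equivariant map from `σ` is a quotient of the induction of `σ`. -/
theorem exists_surjective_of_equivariant (σ : Representation R P W) {π : Representation R G V}
    (hπ : π.IsIrreducible) (f : W →ₗ[R] V) (hf0 : f ≠ 0) (hf : ∀ p w, f (σ p w) = π p (f w)) :
    ∃ F : (Representation.coind P.subtype σ).IntertwiningMap π, Function.Surjective F := by
  classical
  have := Fintype.ofFinite (G ⧸ P)
  -- The term `π g (f (φ g⁻¹))` depends only on the coset `gP`, so the choice of representatives is
  -- harmless.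
  have hout : ∀ (φ : Representation.coindV P.subtype σ) (g : G),
      π (g : G ⧸ P).out (f (φ.1 (g : G ⧸ P).out⁻¹)) = π g (f (φ.1 g⁻¹)) := by
    intro φ g
    obtain ⟨p, hp⟩ := QuotientGroup.mk_out_eq_mul P g
    have h1 : φ.1 ((g : G ⧸ P).out⁻¹) = σ p⁻¹ (φ.1 g⁻¹) := by
      rw [hp, mul_inv_rev]
      exact φ.2 p⁻¹ g⁻¹
    rw [h1, hf, hp, ← Module.End.mul_apply, ← map_mul]
    simp
  let F : Representation.coindV P.subtype σ →ₗ[R] V :=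
    ∑ q : G ⧸ P, π q.out ∘ₗ f ∘ₗ LinearMap.proj (q.out⁻¹) ∘ₗ Submodule.subtype _
  have hF : ∀ φ, F φ = ∑ q : G ⧸ P, π q.out (f (φ.1 q.out⁻¹)) := fun φ => by
    simp only [F, LinearMap.sum_apply]
    rfl
  have hFG : ∀ g φ, F (Representation.coind P.subtype σ g φ) = π g (F φ) := by
    intro g φ
    rw [hF, hF, map_sum]
    refine Fintype.sum_equiv (MulAction.toPerm g⁻¹) _ _ fun q => ?_
    have h1 : g⁻¹ • q = ((g⁻¹ * q.out : G) : G ⧸ P) := by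
      conv_lhs => rw [← QuotientGroup.out_eq' q]
      rfl
    rw [MulAction.toPerm_apply, h1, hout, ← Module.End.mul_apply, ← map_mul, mul_inv_cancel_left,
      mul_inv_rev, inv_inv]
    rfl
  let F' : (Representation.coind P.subtype σ).IntertwiningMap π :=
    ⟨F, fun g => LinearMap.ext (hFG g)⟩
  refine ⟨F', (hπ.surjective_or_eq_zero F').resolve_right fun h0 => hf0 ?_⟩
  ext w
  -- The function supported on `P` with value `w` at `1`; only the trivial coset contributes, giving
  -- `F φ = f w`.
  let φ : Representation.coindV P.subtype σ :=
    ⟨fun g => if h : g ∈ P then σ ⟨g, h⟩ w else 0, fun p g => by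
      change (if h : (p : G) * g ∈ P then σ ⟨p * g, h⟩ w else 0) =
        σ p (if h : g ∈ P then σ ⟨g, h⟩ w else 0)
      by_cases h : g ∈ P
      · rw [dif_pos h, dif_pos (P.mul_mem p.2 h), ← Module.End.mul_apply, ← map_mul]
        rfl
      · rw [dif_neg h, dif_neg (fun h' => h ((P.mul_mem_cancel_left p.2).1 h')), map_zero]⟩
  have h1 : F φ = 0 := congrArg (fun T => T φ) h0
  rw [hF, Fintype.sum_eq_single ((1 : G) : G ⧸ P), hout] at h1
  · have h2 : φ.1 1⁻¹ = w := by
      change (if h : (1 : G)⁻¹ ∈ P then σ ⟨1⁻¹, h⟩ w else 0) = w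
      rw [dif_pos (P.inv_mem P.one_mem)]
      have : (⟨1⁻¹, P.inv_mem P.one_mem⟩ : P) = 1 := Subtype.ext inv_one
      rw [this, map_one, Module.End.one_apply]
    rw [h2, map_one] at h1
    exact h1
  · intro q hq
    have h2 : φ.1 q.out⁻¹ = 0 := dif_neg fun h => hq ?_
    · rw [h2, map_zero, map_zero]
    · rw [← QuotientGroup.out_eq' q]
      exact (QuotientGroup.eq.2 (by simpa using h)).symm

end Frobenius

/-! ### Existence of a cuspidal support. -/

section Support

variable {R : Type u} [Field R] {k : Type v} [Field k] [Fintype k] {n : ℕ}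
  {V : Type w} [AddCommGroup V] [Module R V]

/-- An element of the unipotent radical for a refinement of `c` inside the block `a`. -/
theorem mem_of_mem_unipotentRadical_refine {r : ℕ} {c : Fin n → Fin r} {a : Fin r}
    {b : {i // c i = a} → ℕ} {K : ℕ} (hK : ∀ i, b i < K) {u : GL (Fin n) k}
    (hu : u ∈ unipotentRadical k
      (fun i => (c i : ℕ) * K + if h : c i = a then b ⟨i, h⟩ else 0)) :
    ∃ h : u ∈ parabolic k c, (∀ a', a' ≠ a → diagBlock c a' ⟨u, h⟩ = 1) ∧
      diagBlock c a ⟨u, h⟩ ∈ unipotentRadical k b := by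
  rw [mem_unipotentRadical_iff] at hu
  -- As `b < K`, the labels are ordered lexicographically, first by `c` and then by `b`.
  have hlt : ∀ i j, c j < c i → ((c j : ℕ) * K + if h : c j = a then b ⟨j, h⟩ else 0) ≤
      (c i : ℕ) * K + if h : c i = a then b ⟨i, h⟩ else 0 := by
    intro i j h
    have h1 : (c j : ℕ) + 1 ≤ c i := h
    have h2 := Nat.mul_le_mul_right K h1
    rw [add_mul, one_mul] at h2
    by_cases h3 : c j = a
    · have := hK ⟨j, h3⟩
      rw [dif_pos h3]
      omega
    · rw [dif_neg h3]
      omega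
  refine ⟨fun i j h => ?_, fun a' ha' => Units.ext ?_, ?_⟩
  · rw [hu i j (hlt i j h), Matrix.one_apply_ne]
    rintro rfl
    exact lt_irrefl _ h
  · ext ⟨i, hi⟩ ⟨j, hj⟩
    change u.val i j = (1 : Matrix _ _ k) _ _
    rw [hu i j]
    · simp [Matrix.one_apply]
    · simp [hi, hj, ha']
  · rw [mem_unipotentRadical_iff]
    rintro ⟨i, hi⟩ ⟨j, hj⟩ hij
    change u.val i j = (1 : Matrix _ _ k) _ _
    rw [hu i j]
    · simp [Matrix.one_apply]
    · simp [hi, hj, hij]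

/-- Division by `K` maps the new labels onto the `r` old ones, and it is not injective because block
`a` carries two distinct labels. -/
theorem card_lt_card_image_refine {r : ℕ} {c : Fin n → Fin r} (hc : Function.Surjective c)
    {a : Fin r} {b : {i // c i = a} → ℕ} {K : ℕ} (hK : ∀ i, b i < K) (hb : ∃ i j, b i ≠ b j) :
    r < (Finset.univ.image
      (fun i => (c i : ℕ) * K + if h : c i = a then b ⟨i, h⟩ else 0)).card := by
  set b' : Fin n → ℕ := fun i => (c i : ℕ) * K + if h : c i = a then b ⟨i, h⟩ else 0 with hb'
  obtain ⟨i, j, hij⟩ := hb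
  have hK0 : 0 < K := (Nat.zero_le _).trans_lt (hK i)
  have hdiv : ∀ i, b' i / K = c i := by
    intro i
    have : (if h : c i = a then b ⟨i, h⟩ else 0) < K := by
      split_ifs with h
      · exact hK _
      · exact hK0
    simp only [hb']
    rw [mul_comm, Nat.mul_add_div hK0, Nat.div_eq_of_lt this, add_zero]
  have himg : ((Finset.univ.image b').image (· / K)).card = r := by
    rw [Finset.image_image]
    have h1 : (fun x => x / K) ∘ b' = Fin.val ∘ c := funext hdiv
    rw [h1, ← Finset.image_image, Finset.image_univ_of_surjective hc,
      Finset.card_image_of_injective _ Fin.val_injective, Finset.card_univ, Fintype.card_fin]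
  have hle : ((Finset.univ.image b').image (· / K)).card ≤ (Finset.univ.image b').card :=
    Finset.card_image_le
  rw [himg] at hle
  refine hle.lt_of_ne fun heq => hij ?_
  have hinj := Finset.card_image_iff.1 (himg.trans heq)
  have h1 : b' i = b' j := hinj (by simp) (by simp) (by
    change b' i / K = b' j / K
    rw [hdiv, hdiv, i.2, j.2])
  simpa [hb', i.2, j.2] using h1

/-- The order is a power of `q`, hence of `p`, which is invertible in `R`. -/
theorem card_unipotentRadical_ne_zero {p ℓ : ℕ} [CharP k p] [CharP R ℓ] (hℓp : ℓ ≠ p) {ι α : Type*}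
    [Fintype ι] [DecidableEq ι] [LinearOrder α] (b : ι → α) :
    (Nat.card (unipotentRadical k b) : R) ≠ 0 := by
  obtain ⟨N, hN⟩ := exists_card_unipotentRadical (k := k) b
  obtain ⟨m, hp, hm⟩ := FiniteField.card k p
  rw [hN, hm, Nat.cast_pow, Nat.cast_pow]
  refine pow_ne_zero _ (pow_ne_zero _ fun h => ?_)
  rcases (Nat.dvd_prime hp).1 ((CharP.cast_eq_zero_iff R ℓ p).1 h) with h | h
  · exact CharP.char_ne_one R ℓ h
  · exact hℓp h

/-- Every irreducible representation has a cuspidal support. -/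
theorem exists_isCuspidalSupportOf [DecidableEq k] {p ℓ : ℕ} [CharP k p] [CharP R ℓ] (hℓp : ℓ ≠ p)
    {π : Representation R (GL (Fin n) k) V} (hπ : π.IsIrreducible) :
    ∃ D : CuspidalDatum R k n, D.IsCuspidalSupportOf π := by
  classical
  have := finiteDimensional_of_isIrreducible hπ
  have hnt : ∃ x : V, x ≠ 0 := by
    by_contra! h
    refine @bot_ne_top _ _ _ hπ.toNontrivial (Subrepresentation.toSubmodule_injective ?_)
    exact Submodule.ext fun x => by simp [h x]
  let S : Set ℕ := {N | ∃ b : Fin n → ℕ, (Finset.univ.image b).card = N ∧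
    ∃ x, x ≠ 0 ∧ ∀ u ∈ unipotentRadical k b, π u x = x}
  have hSbdd : BddAbove S := ⟨n, by
    rintro _ ⟨b, rfl, -⟩
    exact Finset.card_image_le.trans (by simp)⟩
  have hSne : S.Nonempty := by
    obtain ⟨x, hx⟩ := hnt
    -- The constant labelling has trivial unipotent radical.
    refine ⟨_, fun _ => 0, rfl, x, hx, fun u hu => ?_⟩
    obtain rfl : u = 1 := Units.ext (Matrix.ext fun i j =>
      mem_unipotentRadical_iff.1 hu i j le_rfl)
    simp
  obtain ⟨b, hb, hbx⟩ := Nat.sSup_mem hSne hSbdd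
  obtain ⟨c, τ, hmono, hsurj, hc⟩ := exists_sorted b
  obtain ⟨x₀, hx₀, hx₀inv⟩ := exists_invariant_of_perm π τ hc hbx
  generalize (Finset.univ.image b).card = r at hb c hmono hsurj hc hx₀inv
  have hmax : ∀ b : Fin n → ℕ, r < (Finset.univ.image b).card →
      ∀ x, (∀ u ∈ unipotentRadical k b, π u x = x) → x = 0 := by
    intro b' hr x hx
    by_contra hx0
    have := le_csSup hSbdd (⟨b', rfl, x, hx0, hx⟩ : (Finset.univ.image b').card ∈ S)
    omega
  let M : Submodule R V :=
    { carrier := {x | ∀ u ∈ unipotentRadical k c, π u x = x}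
      add_mem' := fun {x y} hx hy u hu => by rw [map_add, hx u hu, hy u hu]
      zero_mem' := fun u _ => map_zero _
      smul_mem' := fun a x hx u hu => by rw [map_smul, hx u hu] }
  have hM : ∀ q ∈ parabolic k c, ∀ x ∈ M, π q x ∈ M := by
    intro q hq x hx u hu
    conv_rhs => rw [← hx _ (conj_mem_unipotentRadical hq hu)]
    simp only [← Module.End.mul_apply, ← map_mul]
    simp [mul_assoc]
  -- The radical acts trivially on `M`, so the parabolic acts through its Levi factor.
  have hMlevi : ∀ q : parabolic k c, ∀ x ∈ M, π (leviHom c (leviProj c q)) x = π q.1 x := by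
    intro q x hx
    conv_lhs => rw [← hx _ (leviHom_inv_mul_mem_unipotentRadical q)]
    rw [← Module.End.mul_apply, ← map_mul, mul_inv_cancel_left]
  let τM : Representation R (∀ a, GL {i // c i = a} k) M :=
    { toFun := fun g => (π (leviHom c g)).restrict (hM _ (leviHom_mem_parabolic c g))
      map_one' := by ext; simp
      map_mul' := fun g h => by ext; simp }
  have : Nontrivial M := ⟨⟨x₀, hx₀inv⟩, 0, fun h => hx₀ (congrArg Subtype.val h)⟩
  -- Coordinates move `M` from the universe of `V` to that of `R`, as `CuspidalDatum` requires.
  let e : M ≃ₗ[R] (Fin (Module.finrank R M) → R) := (Module.finBasis R M).equivFun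
  have : Nontrivial (Fin (Module.finrank R M) → R) := e.symm.toEquiv.nontrivial
  obtain ⟨d, ρ, m, hρ, hm0, hm⟩ := exists_equivariant_multilinearMap r
    (fun a => GL {i // c i = a} k) _ (transport τM e)
  let m' : MultilinearMap R (fun a => Fin (d a) → R) V :=
    (M.subtype ∘ₗ e.symm.toLinearMap).compMultilinearMap m
  have hm'M : ∀ w, m' w ∈ M := fun w => (e.symm (m w)).2
  have hm' : ∀ q : parabolic k c, ∀ w, m' (fun a => ρ a (diagBlock c a q) (w a)) =
      π q.1 (m' w) := by
    intro q w
    rw [← hMlevi q _ (hm'M w)]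
    have h1 := congrArg (fun y => (e.symm y).1) (hm (leviProj c q) w)
    simp only [transport_apply, LinearEquiv.symm_apply_apply] at h1
    exact h1
  have hm'0 : ∃ w, m' w ≠ 0 := by
    by_contra! h
    refine hm0 (MultilinearMap.ext fun w => e.symm.injective (Subtype.ext ?_))
    rw [_root_.zero_apply, map_zero]
    exact h w
  -- The vectors killing `m'` in slot `a` form an invariant subspace, which is proper because `m' ≠
  -- 0`.
  have hnondeg : ∀ a (x : Fin (d a) → R), (∀ w, m' (Function.update w a x) = 0) → x = 0 := by
    intro a x hx
    let N : Submodule R (Fin (d a) → R) :=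
      { carrier := {x | ∀ w, m' (Function.update w a x) = 0}
        add_mem' := fun {x y} hx hy w => by rw [MultilinearMap.map_update_add, hx, hy, add_zero]
        zero_mem' := fun w => MultilinearMap.map_update_zero _ _ _
        smul_mem' := fun t x hx w => by rw [MultilinearMap.map_update_smul, hx, smul_zero] }
    rcases eq_bot_or_eq_top_of_invariant (hρ a) N (fun g x hx w => by
      have h1 := hm' ⟨_, leviHom_mem_parabolic c (Pi.mulSingle a g)⟩ (Function.update w a x)
      have h2 : (fun a' => ρ a' (diagBlock c a' ⟨_, leviHom_mem_parabolic c (Pi.mulSingle a g)⟩)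
          (Function.update w a x a')) = Function.update w a (ρ a g x) := by
        ext1 a'
        have h3 : diagBlock c a' ⟨_, leviHom_mem_parabolic c (Pi.mulSingle a g)⟩ =
            Pi.mulSingle (M := fun a => GL {i // c i = a} k) a g a' :=
          congrFun (leviProj_leviHom c (Pi.mulSingle a g)) a'
        rw [h3]
        by_cases h : a' = a
        · subst h
          simp
        · simp [h]
      rw [h2, hx w, map_zero] at h1
      exact h1) with h | h
    · exact (Submodule.mem_bot R).1 (h ▸ (hx : x ∈ N))
    · obtain ⟨w, hw⟩ := hm'0
      have h1 : w a ∈ N := h ▸ Submodule.mem_top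
      exact absurd (by simpa using h1 w) hw
  have hcusp : ∀ a, IsCuspidal (ρ a) := by
    intro a b' y hb'
    by_contra hsub
    obtain ⟨x, hx0, hx⟩ := exists_invariant_of_coinvariants (ρ a) (unipotentRadical k b')
      (card_unipotentRadical_ne_zero hℓp b') y hsub
    have hK : ∀ i, b' i < Finset.univ.sup b' + 1 := fun i =>
      Nat.lt_succ_of_le (Finset.le_sup (Finset.mem_univ i))
    -- With an invariant `x` in slot `a`, every value of `m'` is invariant under the radical of a
    -- partition with more than `r` blocks, so it vanishes by maximality.
    refine hx0 (hnondeg a x fun w => hmax _ (card_lt_card_image_refine hsurj hK hb') _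
      fun u hu => ?_)
    obtain ⟨hup, hu1, hu2⟩ := mem_of_mem_unipotentRadical_refine hK hu
    rw [← hm' ⟨u, hup⟩]
    congr 1
    ext1 a'
    by_cases h : a' = a
    · subst h
      simp [hx _ hu2]
    · simp [hu1 a' h]
  let D : CuspidalDatum R k n :=
    { r := r, b := c, mono := hmono, surj := hsurj, W := fun a => Fin (d a) → R, ρ := ρ
      irreducible := hρ, cuspidal := hcusp }
  refine ⟨D, exists_surjective_of_equivariant D.inflation hπ (PiTensorProduct.lift m')
    (fun h => ?_) fun q t => ?_⟩
  · obtain ⟨w, hw⟩ := hm'0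
    exact hw (by rw [← PiTensorProduct.lift.tprod (φ := m'), h, LinearMap.zero_apply])
  · refine LinearMap.congr_fun (f := PiTensorProduct.lift m' ∘ₗ D.inflation q)
      (g := π q.1 ∘ₗ PiTensorProduct.lift m')
      (PiTensorProduct.ext (MultilinearMap.ext fun w => ?_)) t
    have h1 : D.inflation q (PiTensorProduct.tprod R w) =
        PiTensorProduct.tprod R fun a => ρ a (diagBlock c a q) (w a) :=
      PiTensorProduct.map_tprod _ _
    simp only [LinearMap.compMultilinearMap_apply, LinearMap.comp_apply]
    rw [h1, PiTensorProduct.lift.tprod, PiTensorProduct.lift.tprod, hm']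

end Support

end GodementJacquet

theorem mainTheorem6 {R : Type u} [Field R] [IsAlgClosed R] {k : Type v} [Field k] [Fintype k]
    [DecidableEq k] {p ℓ : ℕ} [CharP k p] [CharP R ℓ] (hℓp : ℓ ≠ p) (n : ℕ)
    (s : R) (hs : s ^ 2 = (Fintype.card (Matrix (Fin n) (Fin n) k) : R))
    {V : Type w} [AddCommGroup V] [Module R V] (π : Representation R (GL (Fin n) k) V)
    (hπ : π.IsIrreducible) :
    (∃ D : GodementJacquet.CuspidalDatum R k n, D.IsCuspidalSupportOf π) ∧
    GodementJacquet.WeakFE s π ∧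
    (∀ D : GodementJacquet.CuspidalDatum R k n, D.IsCuspidalSupportOf π →
      ¬ D.ContainsTrivial → GodementJacquet.StrongFE s π) ∧
    (ℓ ≠ 0 → ℓ ∣ Fintype.card k - 1 → GodementJacquet.StrongFE s π) := by
  obtain ⟨D, hD⟩ := GodementJacquet.exists_isCuspidalSupportOf hℓp hπ
  -- Both alternatives yield the implication that a trivial character in the support forces `q - 1 =
  -- 0` in `R`.
  refine ⟨⟨D, hD⟩, GodementJacquet.weakFE_of_isIrreducible hπ s, fun D hD hT =>
    D.strongFE hπ (fun h => absurd h hT) hD s, fun _ hdvd => D.strongFE hπ (fun _ => ?_) hD s⟩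
  exact (CharP.cast_eq_zero_iff R ℓ _).2 hdvd
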